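/- There is a universal constant $k$ such that for every polynomial $p$ there is a constant $c$ for which the following holds for every $n$. Consider synchronous networks whose nodes have distinct identifiers in $\{1,\dots,n\}$ and weights $w(v)\in\{1,\dots,p(n)\}$. In round $0$ the network is a graph $G_0=(V_0,E_0)$ (for example, a graph without edges). At the beginning of every later round $i$ it changes to $G_i=(V_i,E_i)$ with $V_{i-1}\subseteq V_i$: arbitrarily many edges are inserted or deleted between existing nodes, and arbitrarily many nodes are inserted, each with arbitrary incident edges. A node knows $n$, its identifier, its weight, its current neighbors and the round number modulo $15n$. In every round after round $0$, a node learns which of its incident edges have just appeared or disappeared, then sends a message of at most $c(\lfloor\log_2 n\rfloor+1)$ bits to each neighbor in $G_i$, receives its neighbors' messages, and updates its state. Each node $v$ stores a label $L_v$ with entries $L_v[u]\in\mathbb{Z}_{\ge 0}$, one for each $u\in\{1,\dots,n\}$; for $u\ne v$, $L_v[u]$ is a dual weight of the edge $\{u,v\}$, and $L_v[v]$ is the remaining weight of $v$. The star of $v$ is \emph{consistent} for a graph $G$ if $L_v[u]=0$ for every non-neighbor $u\neq v$, $\sum_u L_v[u]=w(v)$, $L_v[u]=L_u[v]$ for every neighbor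 $u$, and either $L_v[v]=0$ or $L_u[u]=0$ for all neighbors $u$ of $v$. The nodes of $V_0$ start with given labels for which all stars are consistent for $G_0$ (if $E_0=\emptyset$, this means $L_v[v]=w(v)$ and $L_v[u]=0$ for $u\ne v$). Let $\mathrm{changes}(i)$ be the number of topology changes in rounds $1,\dots,i$, where the insertion of a node together with its edges counts as one change. Let $\mathrm{incorrect}(i)$ be the number of rounds $j\in\{0,\dots,i\}$ such that some star is inconsistent for $G_j$ under the labels stored at the beginning or at the end of round $j$. There is a deterministic distributed algorithm for such networks, in which nodes may be marked as dirty, such that for all weights, all sequences $(G_i)_i$ and all consistent starting labels as above: 1. (Amortized complexity $O(1)$.) $\mathrm{incorrect}(i)\le k\cdot\mathrm{changes}(i)$ for every $i\ge 0$. 2. (Approximation.) Whenever all stars are consistent for $G_i$ at the end of round $i$, the set $\{v\in V_i : L_v[v]=0\}$ is a vertex cover of $G_i$ whose weight is at most twice the minimum weight of a vertex cover of $G_i$. 3. (Dirty nodes.) In round $0$ no node is dirty. An inserted node is dirty at the end of the round in which it is inserted. A node that is dirty at the end of a round was already dirty at the end of the previous round, or has just been inserted, or is an endpoint of an edge that has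 just been deleted or has just been inserted between two nodes that were already present; in particular, the insertion of a node marks only the inserted node. At the end of every round $i$, the star of every node $v\in V_i$ that is clean (not dirty) and all of whose neighbors in $G_i$ are clean is consistent for $G_i$. -/

import Mathlib

namespace DynNet

/-- A dynamic network: `nodes i` and `graph i` are the node set and the communication graph at the
beginning of round `i` (after the topology changes of that round).  All nodes have identifiers in
`Fin n`.  Round `0` is the starting point.  Arbitrarily many edges may appear and disappear, and
arbitrarily many nodes may be inserted (with arbitrary edges), in every round; nodes are never
deleted. -/
structure DynamicGraph (n : ℕ) where
  nodes : ℕ → Finset (Fin n)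
  graph : ℕ → SimpleGraph (Fin n)
  adj_mem : ∀ i u v, (graph i).Adj u v → u ∈ nodes i
  nodes_mono : ∀ i, nodes i ⊆ nodes (i + 1)

namespace DynamicGraph

variable {n : ℕ}

/-- The nodes inserted at the beginning of round `i + 1`. -/
def insertedNodes (D : DynamicGraph n) (i : ℕ) : Finset (Fin n) :=
  D.nodes (i + 1) \ D.nodes i

/-- The edges inserted at the beginning of round `i + 1` by an edge insertion, i.e. between two
nodes that were already present.  (The other new edges belong to node insertions.) -/
def insertedEdges (D : DynamicGraph n) (i : ℕ) : Set (Sym2 (Fin n)) :=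
  {e | e ∈ (D.graph (i + 1)).edgeSet ∧ e ∉ (D.graph i).edgeSet ∧ ∀ v ∈ e, v ∈ D.nodes i}

/-- The edges deleted at the beginning of round `i + 1`. -/
def deletedEdges (D : DynamicGraph n) (i : ℕ) : Set (Sym2 (Fin n)) :=
  {e | e ∈ (D.graph i).edgeSet ∧ e ∉ (D.graph (i + 1)).edgeSet}

/-- The number of topology changes until round `i`.  The insertion of a node together with its
edges is a single change. -/
noncomputable def changes (D : DynamicGraph n) (i : ℕ) : ℕ :=
  ∑ j ∈ Finset.range i,
    ((D.insertedNodes j).card + (D.insertedEdges j).ncard + (D.deletedEdges j).ncard)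

end DynamicGraph

/-- The label of a node `v`: the entry at `u ≠ v` is the dual weight of the edge `{u, v}`, the
entry at `v` is the remaining weight of `v`. -/
abbrev Label (n : ℕ) : Type := Fin n → ℕ

/-- A message of at most `B` bits. -/
abbrev Message (B : ℕ) : Type := {l : List Bool // l.length ≤ B}

/-- What a node is told at the beginning of a round: the common clock, its current neighbours, and
the indications, i.e. the other endpoints of its incident edges that have just appeared, and of
those that have just disappeared. -/
structure LocalView (n : ℕ) where
  clock : ℕ
  nbrs : Set (Fin n)
  appeared : Set (Fin n)
  disappeared : Set (Fin n)

/-- A deterministic distributed algorithm for networks with identifiers in `Fin n` and messages of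
at most `B` bits.  In a round a node first gets its local view, then sends a message to each of its
neighbours, then updates its state from the messages of its neighbours (`none` for
non-neighbours). -/
structure Algorithm (n B : ℕ) where
  State : Type
  /-- State of a node present at the start, from its identifier, its weight, its neighbours and its
  given label. -/
  start : Fin n → ℕ → Set (Fin n) → Label n → State
  /-- State of a node just being inserted, from its identifier and its weight. -/
  enter : Fin n → ℕ → State
  send : State → LocalView n → Fin n → Message B
  receive : State → LocalView n → (Fin n → Option (Message B)) → State
  /-- The label that a node stores. -/
  label : State → Label n
  /-- Whether a node is marked as dirty. -/
  dirty : State → Prop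

/-- The local view of `v` at the beginning of round `i + 1`.  As newly inserted nodes need not know
the global round number, the clock shows the round number modulo `15 * n` only. -/
def DynamicGraph.view {n : ℕ} (D : DynamicGraph n) (i : ℕ) (v : Fin n) : LocalView n where
  clock := (i + 1) % (15 * n)
  nbrs := {u | (D.graph (i + 1)).Adj v u}
  appeared := {u | (D.graph (i + 1)).Adj v u ∧ ¬ (D.graph i).Adj v u}
  disappeared := {u | (D.graph i).Adj v u ∧ ¬ (D.graph (i + 1)).Adj v u}

namespace Algorithm

variable {n B : ℕ}

open Classical in
/-- The states at the end of round `i`, when the algorithm runs on `D` with node weights `w` and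
starting labels `L₀`.  A node that has not been inserted yet waits in its `enter` state. -/
noncomputable def run (A : Algorithm n B) (D : DynamicGraph n) (w : Fin n → ℕ)
    (L₀ : Fin n → Label n) : ℕ → Fin n → A.State
  | 0 => fun v =>
      if v ∈ D.nodes 0 then A.start v (w v) {u | (D.graph 0).Adj v u} (L₀ v) else A.enter v (w v)
  | i + 1 => fun v =>
      if v ∈ D.nodes (i + 1) then
        A.receive (run A D w L₀ i v) (D.view i v) (fun u =>
          if (D.graph (i + 1)).Adj u v then some (A.send (run A D w L₀ i u) (D.view i u) v)
          else none)
      else A.enter v (w v)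

/-- The labels at the end of round `i`. -/
noncomputable def labels (A : Algorithm n B) (D : DynamicGraph n) (w : Fin n → ℕ)
    (L₀ : Fin n → Label n) (i : ℕ) (v : Fin n) : Label n :=
  A.label (A.run D w L₀ i v)

/-- `v` is dirty at the end of round `i`. -/
def DirtyAt (A : Algorithm n B) (D : DynamicGraph n) (w : Fin n → ℕ)
    (L₀ : Fin n → Label n) (i : ℕ) (v : Fin n) : Prop :=
  A.dirty (A.run D w L₀ i v)

end Algorithm

/-- The labelled star centred at `v` is consistent: non-neighbours have dual weight `0`, the
remaining weight of `v` is its weight minus the dual weights of its edges, the endpoints of each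
edge agree on its dual weight, and `v` is tight or all its neighbours are. -/
structure StarConsistent {n : ℕ} (w : Fin n → ℕ) (G : SimpleGraph (Fin n))
    (L : Fin n → Label n) (v : Fin n) : Prop where
  zero_of_not_adj : ∀ u, u ≠ v → ¬ G.Adj v u → L v u = 0
  sum_eq : ∑ u, L v u = w v
  agree : ∀ u, G.Adj v u → L v u = L u v
  tight : L v v = 0 ∨ ∀ u, G.Adj v u → L u u = 0

/-- All stars centred at nodes of `V` are consistent. -/
def Consistent {n : ℕ} (w : Fin n → ℕ) (V : Finset (Fin n)) (G : SimpleGraph (Fin n))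
    (L : Fin n → Label n) : Prop :=
  ∀ v ∈ V, StarConsistent w G L v

/-- The set of nodes that a labelling selects: the nodes with remaining weight `0`. -/
def cover {n : ℕ} (V : Finset (Fin n)) (L : Fin n → Label n) : Finset (Fin n) :=
  {v ∈ V | L v v = 0}

/-- `S` is a vertex cover of the graph `G` with node set `V`. -/
def IsCover {n : ℕ} (V : Finset (Fin n)) (G : SimpleGraph (Fin n)) (S : Finset (Fin n)) : Prop :=
  S ⊆ V ∧ G.IsVertexCover (S : Set (Fin n))

/-- `S` is a vertex cover of weight at most twice the minimum weight of a vertex cover. -/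
def IsTwoApproxCover {n : ℕ} (w : Fin n → ℕ) (V : Finset (Fin n)) (G : SimpleGraph (Fin n))
    (S : Finset (Fin n)) : Prop :=
  IsCover V G S ∧ ∀ T, IsCover V G T → ∑ v ∈ S, w v ≤ 2 * ∑ v ∈ T, w v

namespace Algorithm

variable {n B : ℕ}

/-- Round `i` has an inconsistent star with respect to the graph of round `i`, for the labels at
the beginning or for those at the end of the round.  (The labels at the beginning of round `i` are
those at the end of round `i - 1`; for `i = 0` there is only one labelling.) -/
def IncorrectRound (A : Algorithm n B) (D : DynamicGraph n) (w : Fin n → ℕ)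
    (L₀ : Fin n → Label n) (i : ℕ) : Prop :=
  ¬ Consistent w (D.nodes i) (D.graph i) (A.labels D w L₀ (i - 1)) ∨
    ¬ Consistent w (D.nodes i) (D.graph i) (A.labels D w L₀ i)

/-- The number of rounds until round `i` in which there is an inconsistent star. -/
noncomputable def incorrect (A : Algorithm n B) (D : DynamicGraph n) (w : Fin n → ℕ)
    (L₀ : Fin n → Label n) (i : ℕ) : ℕ :=
  {j | j ≤ i ∧ A.IncorrectRound D w L₀ j}.ncard

end Algorithm

end DynNet

namespace DynNet

/-! ### Greedy distribution of a budget -/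

/-! The labels form a dual solution: weights on edges whose sum at a node is at most the weight of
the node, with `L v v` as slack. If every edge has a tight endpoint, the tight nodes form a cover;
their weight counts each dual edge weight at most twice, whereas any cover pays for each edge at
least once. This gives the factor two (`isTwoApproxCover_of_consistent`).

Dual feasibility and agreement are maintained in every round (`Invariant.evolve`). Only tightness of
edges may fail, and only at dirty nodes. A deleted edge returns its dual weight to its endpoints; a
new edge starts with dual weight zero. Such changes mark both endpoints, except that a newcomer
announces itself by a flag in its first message, so that its old neighbours need not be marked.

Repair works in windows of three rounds. Dirty nodes announce themselves, and every node picks the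
least dirty node in its closed neighbourhood; then it grants its slack to that node; then a node
that picked itself spends its own slack against the grants. If all its neighbours have granted, it
becomes clean: either its slack is used up or it has absorbed every grant. As each node serves only
one node, simultaneous repairs never overspend (`Invariant.sum_flow_le`).

All neighbours of the least dirty node of the network pick it, so a window without changes reduces
the number of dirty nodes (`card_dirtyNodes_lt`), while a change adds at most two
(`Invariant.card_dirtyNodes_evolve_le`). A potential argument (`card_busy_le`) turns this into the
amortized bound with constant 9. -/

/-- The requests `r` are served in the order of the identifiers, as far as the budget `b` allows. -/
def greedy {n : ℕ} (b : ℕ) (r : Fin n → ℕ) (u : Fin n) : ℕ :=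
  min (r u) (b - ∑ x with x < u, r x)

theorem greedy_le {n : ℕ} (b : ℕ) (r : Fin n → ℕ) (u : Fin n) : greedy b r u ≤ r u :=
  min_le_left _ _

theorem greedy_le_budget {n : ℕ} (b : ℕ) (r : Fin n → ℕ) (u : Fin n) : greedy b r u ≤ b :=
  (min_le_right _ _).trans (Nat.sub_le _ _)

/-- Each share depends only on requests of smaller identifiers, so adding a maximal identifier
leaves the earlier shares unchanged. -/
theorem sum_greedy {n : ℕ} (b : ℕ) (r : Fin n → ℕ) :
    ∑ u, greedy b r u = min b (∑ u, r u) := by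
  have key : ∀ S : Finset (Fin n),
      ∑ u ∈ S, min (r u) (b - ∑ x ∈ S with x < u, r x) = min b (∑ u ∈ S, r u) := by
    intro S
    induction S using Finset.induction_on_max with
    | empty => simp
    | insert a S ha ih =>
      have haS : a ∉ S := fun h => lt_irrefl a (ha a h)
      rw [Finset.sum_insert haS, Finset.sum_insert haS]
      have h1 : ((insert a S).filter fun x => x < a) = S := by
        ext x
        simp only [Finset.mem_filter, Finset.mem_insert]
        constructor
        · rintro ⟨rfl | h, h'⟩
          · exact absurd h' (lt_irrefl _)
          · exact h
        · exact fun h => ⟨Or.inr h, ha x h⟩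
      have h2 : ∀ u ∈ S, ((insert a S).filter fun x => x < u) = S.filter fun x => x < u := by
        intro u hu
        rw [Finset.filter_insert, if_neg (not_lt.2 (ha u hu).le)]
      have h3 : ∑ u ∈ S, min (r u) (b - ∑ x ∈ insert a S with x < u, r x) =
          ∑ u ∈ S, min (r u) (b - ∑ x ∈ S with x < u, r x) :=
        Finset.sum_congr rfl fun u hu => by rw [h2 u hu]
      rw [h1, h3, ih]
      omega
  exact key Finset.univ

/-- A budget that is not exhausted has truncated no request. This yields the alternative behind
cleaning a node. -/
theorem greedy_eq_of_sum_lt {n : ℕ} {b : ℕ} {r : Fin n → ℕ} (h : ∑ u, greedy b r u < b)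
    (u : Fin n) : greedy b r u = r u := by
  have hs : ∑ u, greedy b r u = ∑ u, r u := by
    have := sum_greedy b r
    omega
  exact (Finset.sum_eq_sum_iff_of_le fun u _ => greedy_le b r u).1 hs u (Finset.mem_univ u)

/-! ### Messages -/

/-- The number with the given binary digits, the least significant digit first. -/
def ofBits (l : List Bool) : ℕ :=
  l.foldr Nat.bit 0

theorem ofBits_bits (m : ℕ) : ofBits m.bits = m := by
  induction m using Nat.binaryRec' with
  | zero => simp [ofBits]
  | bit b m h ih =>
    rw [Nat.bits_append_bit m b h]
    exact congrArg (Nat.bit b) ih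

/-- A flag and a number, as a message of at most `B` bits. -/
def encode (B : ℕ) (x : Bool × ℕ) : Message B :=
  -- Truncation makes the encoding total; in actual runs nothing is cut off.
  ⟨(x.1 :: x.2.bits).take B, by simp⟩

/-- The flag and the number in a message. -/
def decode {B : ℕ} (m : Message B) : Bool × ℕ :=
  (m.1.headD false, ofBits m.1.tail)

theorem decode_encode {B : ℕ} {x : Bool × ℕ} (h : x.2.size + 1 ≤ B) :
    decode (encode B x) = x := by
  have h' : (x.1 :: x.2.bits).take B = x.1 :: x.2.bits :=
    List.take_of_length_le (by simpa [Nat.size_eq_bits_len] using h)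
  simp [decode, encode, h', ofBits_bits]

theorem exists_eval_lt_two_pow (p : Polynomial ℕ) :
    ∃ c : ℕ, ∀ n : ℕ, p.eval n < 2 ^ (c * (Nat.log 2 n + 1)) := by
  induction p using Polynomial.induction_on' with
  | add p q hp hq =>
    obtain ⟨a, ha⟩ := hp
    obtain ⟨b, hb⟩ := hq
    refine ⟨a + b + 1, fun n => ?_⟩
    rw [Polynomial.eval_add]
    have h1 : 2 ^ (a * (Nat.log 2 n + 1)) ≤ 2 ^ ((a + b) * (Nat.log 2 n + 1)) :=
      Nat.pow_le_pow_right two_pos (Nat.mul_le_mul_right _ (by omega))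
    have h2 : 2 ^ (b * (Nat.log 2 n + 1)) ≤ 2 ^ ((a + b) * (Nat.log 2 n + 1)) :=
      Nat.pow_le_pow_right two_pos (Nat.mul_le_mul_right _ (by omega))
    have h3 : 2 ^ ((a + b) * (Nat.log 2 n + 1) + 1) ≤ 2 ^ ((a + b + 1) * (Nat.log 2 n + 1)) :=
      Nat.pow_le_pow_right two_pos (by rw [Nat.add_mul (a + b) 1]; omega)
    rw [pow_succ] at h3
    have := ha n
    have := hb n
    omega
  | monomial d a =>
    refine ⟨a.size + d, fun n => ?_⟩
    rw [Polynomial.eval_monomial, Nat.add_mul, pow_add, mul_comm d, pow_mul _ _ d]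
    have h1 : a < 2 ^ (a.size * (Nat.log 2 n + 1)) :=
      (Nat.lt_size_self a).trans_le
        (Nat.pow_le_pow_right two_pos (Nat.le_mul_of_pos_right _ (Nat.succ_pos _)))
    have h2 : n ^ d ≤ (2 ^ (Nat.log 2 n + 1)) ^ d :=
      Nat.pow_le_pow_left (Nat.lt_pow_succ_log_self one_lt_two n).le d
    exact Nat.mul_lt_mul_of_lt_of_le h1 h2 (by positivity)

/-- One extra bit is for the flag; the bound is `p.eval n + 1` because grants are sent increased by
one. -/
theorem exists_size_le (p : Polynomial ℕ) :
    ∃ c : ℕ, ∀ n m : ℕ, m ≤ p.eval n + 1 → m.size + 1 ≤ c * (Nat.log 2 n + 1) := by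
  obtain ⟨c, hc⟩ := exists_eval_lt_two_pow (p + 1)
  refine ⟨c + 1, fun n m hm => ?_⟩
  have h := hc n
  rw [Polynomial.eval_add, Polynomial.eval_one] at h
  have : m.size ≤ c * (Nat.log 2 n + 1) := Nat.size_le.2 (hm.trans_lt h)
  rw [Nat.add_mul]
  omega

/-! ### Amortization -/

-- Here `f` counts dirty nodes and `a` counts changes. A window with `x ≥ 1` changes has at most
-- three busy rounds and raises `3 * f` by at most `6 * x`, a cost of at most `9 * x`. A busy window
-- without changes pays for its three rounds by the drop of `f`.
open Classical in
theorem card_busy_le {f a : ℕ → ℕ} (h0 : f 0 = 0) (hstep : ∀ i, f (i + 1) ≤ f i + 2 * a i)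
    (hdrop : ∀ t, 0 < f (3 * t) → a (3 * t) = 0 → a (3 * t + 1) = 0 → a (3 * t + 2) = 0 →
      f (3 * t + 3) < f (3 * t)) (i : ℕ) :
    ((Finset.range i).filter fun j => 0 < f j ∨ 0 < a j).card ≤ 9 * ∑ j ∈ Finset.range i, a j := by
  set N : ℕ → ℕ := fun i => ((Finset.range i).filter fun j => 0 < f j ∨ 0 < a j).card with hN
  set A : ℕ → ℕ := fun i => ∑ j ∈ Finset.range i, a j with hA
  have hA1 : ∀ i, A (i + 1) = A i + a i := fun i => Finset.sum_range_succ a i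
  have hN1 : ∀ i, N (i + 1) = N i + if 0 < f i ∨ 0 < a i then 1 else 0 := by
    intro i
    simp only [hN, Finset.range_add_one, Finset.filter_insert]
    split_ifs <;> simp
  have hwin : ∀ t, N (3 * t) + 3 * f (3 * t) ≤ 9 * A (3 * t) := by
    intro t
    induction t with
    | zero => simp [hN, hA, h0]
    | succ t ih =>
      have := hdrop t
      have := hstep (3 * t)
      have := hstep (3 * t + 1)
      have := hstep (3 * t + 2)
      have := hA1 (3 * t)
      have := hA1 (3 * t + 1)
      have := hA1 (3 * t + 2)
      have e0 := hN1 (3 * t)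
      have e1 := hN1 (3 * t + 1)
      have e2 := hN1 (3 * t + 2)
      rw [show 3 * (t + 1) = 3 * t + 3 by ring]
      simp only [add_assoc, Nat.reduceAdd] at *
      split_ifs at e0 e1 e2 <;> omega
  -- The rounds of an unfinished window are paid for by the potential at its start or by changes
  -- inside it.
  have hi : i = 3 * (i / 3) ∨ i = 3 * (i / 3) + 1 ∨ i = 3 * (i / 3) + 2 := by omega
  change N i ≤ 9 * A i
  generalize i / 3 = t at hi
  have := hwin t
  have := hstep (3 * t)
  have := hA1 (3 * t)
  have := hA1 (3 * t + 1)
  have e0 := hN1 (3 * t)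
  have e1 := hN1 (3 * t + 1)
  simp only [add_assoc, Nat.reduceAdd] at *
  rcases hi with rfl | rfl | rfl
  · omega
  · split_ifs at e0 <;> omega
  · split_ifs at e0 e1 <;> omega

/-! ### Consistent labels -/

theorem isTwoApproxCover_of_consistent {n : ℕ} {w : Fin n → ℕ} {V : Finset (Fin n)}
    {G : SimpleGraph (Fin n)} {L : Fin n → Label n} (hV : ∀ u v, G.Adj u v → u ∈ V)
    (h : Consistent w V G L) : IsTwoApproxCover w V G (cover V L) := by
  classical
  refine ⟨⟨Finset.filter_subset _ _, ?_⟩, fun T hT => ?_⟩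
  · intro u v huv
    have hu := hV u v huv
    have hv := hV v u huv.symm
    rcases (h u hu).tight with h' | h'
    · exact Or.inl (by simp [cover, hu, h'])
    · exact Or.inr (by simp [cover, hv, h' v huv])
  · set d : Fin n → Fin n → ℕ := fun v u => if G.Adj v u then L v u else 0 with hd
    have hsymm : ∀ v u, d v u = d u v := by
      intro v u
      by_cases hvu : G.Adj v u
      · simp only [hd, if_pos hvu, if_pos hvu.symm]
        exact (h v (hV v u hvu)).agree u hvu
      · have : ¬ G.Adj u v := fun h => hvu h.symm
        simp only [hd, if_neg hvu, if_neg this]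
    have hw : ∀ v ∈ V, w v = L v v + ∑ u, d v u := by
      intro v hv
      rw [← (h v hv).sum_eq, ← Finset.add_sum_erase _ _ (Finset.mem_univ v),
        ← Finset.add_sum_erase _ (d v) (Finset.mem_univ v)]
      have : d v v = 0 := by simp [hd]
      rw [this, zero_add]
      congr 1
      refine Finset.sum_congr rfl fun u hu => ?_
      by_cases hvu : G.Adj v u
      · simp [hd, hvu]
      · simp [hd, hvu, (h v hv).zero_of_not_adj u (Finset.ne_of_mem_erase hu) hvu]
    -- The dual weight of every edge is charged to an endpoint in `T`.
    have hcov : ∀ v u, d v u ≤ (if v ∈ T then d v u else 0) + (if u ∈ T then d u v else 0) := by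
      intro v u
      by_cases hvu : G.Adj v u
      · rcases hT.2 hvu with h' | h'
        · have h' : v ∈ T := h'
          rw [if_pos h']
          omega
        · have h' : u ∈ T := h'
          rw [if_pos h', hsymm v u]
          omega
      · simp [hd, hvu]
    calc ∑ v ∈ cover V L, w v = ∑ v ∈ cover V L, ∑ u, d v u := by
          refine Finset.sum_congr rfl fun v hv => ?_
          rw [cover, Finset.mem_filter] at hv
          rw [hw v hv.1, hv.2, zero_add]
      _ ≤ ∑ v, ∑ u, d v u := Finset.sum_le_sum_of_subset (Finset.subset_univ _)
      _ ≤ ∑ v, ∑ u, ((if v ∈ T then d v u else 0) + (if u ∈ T then d u v else 0)) :=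
          Finset.sum_le_sum fun v _ => Finset.sum_le_sum fun u _ => hcov v u
      _ = 2 * ∑ v ∈ T, ∑ u, d v u := by
          have e : ∑ v, ∑ u, (if v ∈ T then d v u else 0) = ∑ v ∈ T, ∑ u, d v u := by
            have e0 : ∀ v, ∑ u, (if v ∈ T then d v u else 0) = if v ∈ T then ∑ u, d v u else 0 := by
              intro v
              split_ifs
              · rfl
              · exact Finset.sum_const_zero
            simp only [e0, Finset.sum_ite_mem, Finset.univ_inter]
          have e' : ∑ v, ∑ u, (if u ∈ T then d u v else 0) = ∑ v ∈ T, ∑ u, d v u := by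
            rw [Finset.sum_comm, e]
          simp only [Finset.sum_add_distrib]
          rw [e, e', two_mul]
      _ ≤ 2 * ∑ v ∈ T, w v :=
          Nat.mul_le_mul_left _ (Finset.sum_le_sum fun v hv => by rw [hw v (hT.1 hv)]; omega)

end DynNet

namespace DynNet

/-! ### The algorithm -/

/-- The state of a node in the vertex cover algorithm.  `fresh` says that the node has not taken
part in a round yet, `best` is the dirty node that it currently serves, and `grants u` is one more
than the remaining weight that `u` has granted to it, or `0` if there is no such grant. -/
structure NodeState (n : ℕ) where
  id : Fin n
  label : Label n
  dirty : Prop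
  fresh : Bool
  best : WithTop (Fin n)
  grants : Fin n → ℕ

open Classical in
/-- The label of `v` after the dual weights of the edges to `X` have been returned to `v`. -/
noncomputable def prune {n : ℕ} (v : Fin n) (L : Label n) (X : Set (Fin n)) : Label n := fun u =>
  if u = v then L v + ∑ x with x ∈ X, L x else if u ∈ X then 0 else L u

/-- The label of `v` after the weight `f u` has been moved from `v` to the edge to `u`. -/
def transfer {n : ℕ} (v : Fin n) (L : Label n) (f : Fin n → ℕ) : Label n := fun u =>
  if u = v then L v - ∑ x, f x else L u + f u

/-- The phase of a round of the given clock. -/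
def phase (clock : ℕ) : ℕ :=
  -- The shift gives round `i + 1` the phase `i % 3`.
  (clock + 2) % 3

/-! ### State transition of a node -/

namespace NodeState

variable {n : ℕ}

/-- A node present at the start is clean and has its given label. -/
def start (v : Fin n) (L : Label n) : NodeState n :=
  ⟨v, L, False, false, ⊤, 0⟩

/-- An inserted node is dirty, and none of its weight is on its edges. -/
def enter (v : Fin n) (w : ℕ) : NodeState n :=
  ⟨v, Pi.single v w, True, true, ⊤, 0⟩

/-- The label after the edges that have disappeared are discarded. -/
noncomputable def pruned (s : NodeState n) (X : LocalView n) : Label n :=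
  prune s.id s.label X.disappeared

open Classical in
/-- The weights that the neighbours have granted to a node that is its own best dirty node. -/
noncomputable def requests (s : NodeState n) (X : LocalView n) (u : Fin n) : ℕ :=
  if s.best = s.id ∧ u ∈ X.nbrs then s.grants u - 1 else 0

/-- A node that is its own best dirty node distributes its remaining weight among the neighbours
that have granted theirs. -/
noncomputable def outflow (s : NodeState n) (X : LocalView n) : Fin n → ℕ :=
  greedy (s.pruned X s.id) (s.requests X)

open Classical in
/-- The number sent to `u`: whether the node is dirty in phase `0`, the granted weight in phase
`1`, and the additional dual weight of the edge in phase `2`. -/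
noncomputable def payload (s : NodeState n) (X : LocalView n) (u : Fin n) : ℕ :=
  if phase X.clock = 0 then (if s.dirty then 1 else 0)
  -- The increment distinguishes a grant of zero weight from no grant.
  else if phase X.clock = 1 then (if s.best = u then s.pruned X s.id + 1 else 0)
  else s.outflow X u

/-- The node has seen a change of an edge that is not due to the insertion of a neighbour. -/
def Marked (X : LocalView n) (m : Fin n → Bool × ℕ) : Prop :=
  X.disappeared.Nonempty ∨ ∃ u ∈ X.appeared, (m u).1 = false

/-- The node becomes clean, as all its neighbours have granted their weights. -/
def Cleaned (s : NodeState n) (X : LocalView n) : Prop :=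
  phase X.clock = 2 ∧ s.best = s.id ∧ ∀ u ∈ X.nbrs, s.grants u ≠ 0

open Classical in
/-- The state after a round with received flags and numbers `m`. -/
noncomputable def next (s : NodeState n) (X : LocalView n) (m : Fin n → Bool × ℕ) :
    NodeState n where
  id := s.id
  label := transfer s.id (s.pruned X) fun u =>
    if phase X.clock = 2 then s.outflow X u + (m u).2 else 0
  -- Cleaning overrides marks of the same round: the weight distributed already includes what
  -- deleted edges return, and every current neighbour has granted.
  dirty := ¬ s.Cleaned X ∧ (s.dirty ∨ Marked X m)
  fresh := false
  best := if phase X.clock = 0 then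
      ({x | x = s.id ∧ s.dirty ∨ (m x).2 ≠ 0} : Finset (Fin n)).min
    else s.best
  grants := if phase X.clock = 1 then fun u => (m u).2 else s.grants

end NodeState

/-- The algorithm with messages of at most `B` bits. -/
noncomputable def coverAlgorithm (n B : ℕ) : Algorithm n B where
  State := NodeState n
  start v _ _ L := NodeState.start v L
  enter := NodeState.enter
  send s X u := encode B (s.fresh, s.payload X u)
  receive s X m := s.next X fun u => (m u).elim (false, 0) decode
  label := NodeState.label
  dirty := NodeState.dirty

section

variable {n : ℕ}

open Classical in
/-- What `v` receives in round `i + 1` if the states before it are `S`. -/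
noncomputable def DynamicGraph.received (D : DynamicGraph n) (i : ℕ) (S : Fin n → NodeState n)
    (v u : Fin n) : Bool × ℕ :=
  if (D.graph (i + 1)).Adj u v then ((S u).fresh, (S u).payload (D.view i u) v) else (false, 0)

open Classical in
/-- The states after round `i + 1` if the states before it are `S`. -/
noncomputable def DynamicGraph.evolve (D : DynamicGraph n) (w : Fin n → ℕ) (i : ℕ)
    (S : Fin n → NodeState n) (v : Fin n) : NodeState n :=
  if v ∈ D.nodes (i + 1) then (S v).next (D.view i v) (D.received i S v)
  else NodeState.enter v (w v)

theorem DynamicGraph.evolve_of_mem (D : DynamicGraph n) (w : Fin n → ℕ) (i : ℕ)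
    (S : Fin n → NodeState n) {v : Fin n} (hv : v ∈ D.nodes (i + 1)) :
    D.evolve w i S v = (S v).next (D.view i v) (D.received i S v) :=
  if_pos hv

theorem DynamicGraph.evolve_of_notMem (D : DynamicGraph n) (w : Fin n → ℕ) (i : ℕ)
    (S : Fin n → NodeState n) {v : Fin n} (hv : v ∉ D.nodes (i + 1)) :
    D.evolve w i S v = NodeState.enter v (w v) :=
  if_neg hv

theorem DynamicGraph.evolve_dirty (D : DynamicGraph n) (w : Fin n → ℕ) (i : ℕ)
    (S : Fin n → NodeState n) {v : Fin n} (hv : v ∈ D.nodes (i + 1)) :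
    (D.evolve w i S v).dirty ↔ ¬ (S v).Cleaned (D.view i v) ∧
      ((S v).dirty ∨ NodeState.Marked (D.view i v) (D.received i S v)) := by
  rw [D.evolve_of_mem w i S hv]
  rfl

/-- Since 3 divides `15 * n`, the reduced clock still determines the phase, so newcomers are
synchronized. -/
theorem DynamicGraph.phase_view (D : DynamicGraph n) (i : ℕ) (v : Fin n) :
    phase (D.view i v).clock = i % 3 := by
  have h : (i + 1) % (15 * n) % 3 = (i + 1) % 3 := Nat.mod_mod_of_dvd _ ⟨5 * n, by ring⟩
  simp only [phase, DynamicGraph.view]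
  omega

/-! ### Pruning and transferring -/

theorem prune_self_ge (v : Fin n) (L : Label n) (X : Set (Fin n)) : L v ≤ prune v L X v := by
  simp [prune]

theorem prune_self_of_empty (v : Fin n) (L : Label n) {X : Set (Fin n)} (h : ¬ X.Nonempty) :
    prune v L X v = L v := by
  simp [prune, Set.not_nonempty_iff_eq_empty.1 h]

theorem sum_prune (v : Fin n) (L : Label n) {X : Set (Fin n)} (h : v ∉ X) :
    ∑ u, prune v L X u = ∑ u, L u := by
  classical
  rw [← Finset.add_sum_erase _ _ (Finset.mem_univ v),
    ← Finset.add_sum_erase _ L (Finset.mem_univ v)]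
  have h1 : ∑ x with x ∈ X, L x = ∑ x ∈ Finset.univ.erase v, if x ∈ X then L x else 0 := by
    rw [Finset.sum_filter, ← Finset.add_sum_erase _ _ (Finset.mem_univ v), if_neg h, zero_add]
  have h2 : prune v L X v = L v + ∑ x with x ∈ X, L x := by simp [prune]
  rw [h2, h1, add_assoc, ← Finset.sum_add_distrib]
  congr 1
  refine Finset.sum_congr rfl fun u hu => ?_
  simp only [prune, if_neg (Finset.ne_of_mem_erase hu)]
  split_ifs <;> simp

theorem transfer_self (v : Fin n) (L : Label n) (f : Fin n → ℕ) :
    transfer v L f v = L v - ∑ x, f x :=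
  if_pos rfl

theorem transfer_of_ne {v u : Fin n} (h : u ≠ v) (L : Label n) (f : Fin n → ℕ) :
    transfer v L f u = L u + f u :=
  if_neg h

theorem sum_transfer {v : Fin n} {L : Label n} {f : Fin n → ℕ} (hf : f v = 0)
    (h : ∑ u, f u ≤ L v) : ∑ u, transfer v L f u = ∑ u, L u := by
  rw [← Finset.add_sum_erase _ _ (Finset.mem_univ v),
    ← Finset.add_sum_erase _ L (Finset.mem_univ v), transfer_self]
  have h1 : ∑ u ∈ Finset.univ.erase v, transfer v L f u =
      ∑ u ∈ Finset.univ.erase v, (L u + f u) :=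
    Finset.sum_congr rfl fun u hu => transfer_of_ne (Finset.ne_of_mem_erase hu) L f
  have h2 : ∑ u, f u = ∑ u ∈ Finset.univ.erase v, f u := by
    rw [← Finset.add_sum_erase _ _ (Finset.mem_univ v), hf, zero_add]
  rw [h1, Finset.sum_add_distrib]
  omega

/-! ### The invariant -/

/-- The states `S` at the end of round `i`. -/
structure Invariant (w : Fin n → ℕ) (V : Finset (Fin n)) (G : SimpleGraph (Fin n)) (i : ℕ)
    (S : Fin n → NodeState n) : Prop where
  absent : ∀ v, v ∉ V → S v = NodeState.enter v (w v)
  not_fresh : ∀ v ∈ V, (S v).fresh = false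
  id_eq : ∀ v, (S v).id = v
  zero_of_not_adj : ∀ v u, u ≠ v → ¬ G.Adj v u → (S v).label u = 0
  sum_eq : ∀ v, ∑ u, (S v).label u = w v
  agree : ∀ v u, G.Adj v u → (S v).label u = (S u).label v
  -- This is the only clause about labels that dirty nodes weaken.
  tight : ∀ v u, G.Adj v u → ¬ (S v).dirty → ¬ (S u).dirty →
    (S v).label v = 0 ∨ (S u).label u = 0
  -- Needed only just before phase `2`; a grant must still be covered by the current slack of the
  -- granting node, which serves nobody else.
  granted : i % 3 = 2 → ∀ v u, (S v).grants u ≠ 0 →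
    G.Adj v u ∧ (S u).best = v ∧ (S v).grants u = (S u).label u + 1

theorem NodeState.sum_enter (v : Fin n) (k : ℕ) : ∑ u, (enter v k).label u = k := by
  simp [enter]

namespace Invariant

variable {D : DynamicGraph n} {w : Fin n → ℕ} {i : ℕ} {S : Fin n → NodeState n}

theorem initial {L₀ : Fin n → Label n} (h : Consistent w (D.nodes 0) (D.graph 0) L₀)
    (hS : ∀ v ∈ D.nodes 0, S v = NodeState.start v (L₀ v))
    (hS' : ∀ v, v ∉ D.nodes 0 → S v = NodeState.enter v (w v)) :
    Invariant w (D.nodes 0) (D.graph 0) 0 S where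
  absent := hS'
  not_fresh v hv := by rw [hS v hv]; rfl
  id_eq v := by
    by_cases hv : v ∈ D.nodes 0
    · rw [hS v hv]; rfl
    · rw [hS' v hv]; rfl
  zero_of_not_adj v u hu hvu := by
    by_cases hv : v ∈ D.nodes 0
    · rw [hS v hv]; exact (h v hv).zero_of_not_adj u hu hvu
    · rw [hS' v hv]; exact Pi.single_eq_of_ne hu _
  sum_eq v := by
    by_cases hv : v ∈ D.nodes 0
    · rw [hS v hv]; exact (h v hv).sum_eq
    · rw [hS' v hv]; exact NodeState.sum_enter v _
  agree v u hvu := by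
    rw [hS v (D.adj_mem _ _ _ hvu), hS u (D.adj_mem _ _ _ hvu.symm)]
    exact (h v (D.adj_mem _ _ _ hvu)).agree u hvu
  tight v u hvu _ _ := by
    rw [hS v (D.adj_mem _ _ _ hvu), hS u (D.adj_mem _ _ _ hvu.symm)]
    exact (h v (D.adj_mem _ _ _ hvu)).tight.imp_right fun h' => h' u hvu
  granted h := by simp at h

/-! ### Preservation of the invariant in one round -/

variable (hI : Invariant w (D.nodes i) (D.graph i) i S)
include hI

theorem pruned_eq (v : Fin n) :
    (S v).pruned (D.view i v) = prune v (S v).label (D.view i v).disappeared := by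
  rw [NodeState.pruned, hI.id_eq]

theorem pruned_of_adj {v u : Fin n} (hvu : (D.graph (i + 1)).Adj v u) :
    (S v).pruned (D.view i v) u = (S v).label u := by
  have h : u ∉ (D.view i v).disappeared := fun h => h.2 hvu
  rw [hI.pruned_eq, prune, if_neg hvu.ne', if_neg h]

theorem pruned_zero_of_not_adj {v u : Fin n} (hu : u ≠ v) (hvu : ¬ (D.graph (i + 1)).Adj v u) :
    (S v).pruned (D.view i v) u = 0 := by
  rw [hI.pruned_eq, prune, if_neg hu]
  split_ifs with h
  · rfl
  · exact hI.zero_of_not_adj v u hu fun h' => h ⟨h', hvu⟩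

theorem label_eq_of_adj_succ {v u : Fin n} (hvu : (D.graph (i + 1)).Adj v u) :
    (S v).label u = (S u).label v := by
  by_cases h : (D.graph i).Adj v u
  · exact hI.agree v u h
  · rw [hI.zero_of_not_adj v u hvu.ne' h, hI.zero_of_not_adj u v hvu.ne fun h' => h h'.symm]

theorem sum_pruned (v : Fin n) : ∑ u, (S v).pruned (D.view i v) u = w v := by
  rw [hI.pruned_eq, sum_prune _ _ fun h => h.1.ne rfl, hI.sum_eq]

theorem pruned_self_le (v : Fin n) : (S v).pruned (D.view i v) v ≤ w v := by
  rw [← hI.sum_pruned v]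
  exact Finset.single_le_sum (f := (S v).pruned (D.view i v)) (fun _ _ => Nat.zero_le _)
    (Finset.mem_univ v)

theorem label_le_pruned (v : Fin n) : (S v).label v ≤ (S v).pruned (D.view i v) v := by
  rw [hI.pruned_eq]
  exact prune_self_ge _ _ _

theorem pruned_self_of_empty {v : Fin n} (h : ¬ (D.view i v).disappeared.Nonempty) :
    (S v).pruned (D.view i v) v = (S v).label v := by
  rw [hI.pruned_eq, prune_self_of_empty _ _ h]

theorem payload_le (v u : Fin n) : (S v).payload (D.view i v) u ≤ w v + 1 := by
  have h := hI.pruned_self_le v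
  have h' : (S v).outflow (D.view i v) u ≤ (S v).pruned (D.view i v) (S v).id :=
    greedy_le_budget _ _ _
  rw [hI.id_eq] at h'
  unfold NodeState.payload
  rw [hI.id_eq]
  split_ifs <;> omega

/-- Weight flows only along a current edge and against a grant, so the receiver is committed to `v`
alone and can match the amount. -/
theorem of_outflow_ne_zero (hi : i % 3 = 2) {v u : Fin n}
    (h : (S v).outflow (D.view i v) u ≠ 0) :
    (S v).best = v ∧ (D.graph (i + 1)).Adj v u ∧ (S u).best = v ∧
      (S v).outflow (D.view i v) u ≤ (S u).label u := by
  have h1 : (S v).outflow (D.view i v) u ≤ (S v).requests (D.view i v) u := greedy_le _ _ u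
  unfold NodeState.requests at h1
  split_ifs at h1 with h2
  · rw [hI.id_eq] at h2
    obtain ⟨-, h3, h4⟩ := hI.granted hi v u (by omega)
    exact ⟨h2.1, h2.2, h3, by omega⟩
  · omega

/-- The total weight that `v` moves to its edges in phase `2`. -/
theorem sum_flow_le (hi : i % 3 = 2) (v : Fin n) :
    ∑ u, ((S v).outflow (D.view i v) u + (S u).outflow (D.view i u) v) ≤
      (S v).pruned (D.view i v) v := by
  rw [Finset.sum_add_distrib]
  have hout : ∑ u, (S v).outflow (D.view i v) u ≤ (S v).pruned (D.view i v) v := by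
    have h := (sum_greedy ((S v).pruned (D.view i v) (S v).id)
      ((S v).requests (D.view i v))).le.trans (min_le_left _ _)
    rw [hI.id_eq] at h
    simpa only [NodeState.outflow, hI.id_eq] using h
  -- A node serving itself gets no inflow; any other node has no outflow, and inflow only from the
  -- single node it serves.
  by_cases hb : (S v).best = v
  · have : ∑ u, (S u).outflow (D.view i u) v = 0 := by
      refine Finset.sum_eq_zero fun u _ => ?_
      by_contra h
      obtain ⟨-, h1, h2, -⟩ := hI.of_outflow_ne_zero hi h
      exact h1.ne (WithTop.coe_injective (h2.symm.trans hb))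
    omega
  · have h0 : ∑ u, (S v).outflow (D.view i v) u = 0 := by
      refine Finset.sum_eq_zero fun u _ => ?_
      by_contra h
      exact hb (hI.of_outflow_ne_zero hi h).1
    rw [h0, zero_add]
    -- The grant predates the deletions of this round, which can only increase the slack.
    refine le_trans ?_ (hI.label_le_pruned v)
    by_cases hz : ∃ u, (S u).outflow (D.view i u) v ≠ 0
    · obtain ⟨u, hu⟩ := hz
      obtain ⟨-, -, h2, h3⟩ := hI.of_outflow_ne_zero hi hu
      rw [Finset.sum_eq_single u _ fun h => absurd (Finset.mem_univ u) h]
      · exact h3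
      · intro x _ hx
        by_contra h
        exact hx (WithTop.coe_injective ((hI.of_outflow_ne_zero hi h).2.2.1.symm.trans h2))
    · push Not at hz
      simp [hz]

theorem received_two (hi : i % 3 = 2) (v u : Fin n) :
    (D.received i S v u).2 = (S u).outflow (D.view i u) v := by
  unfold DynamicGraph.received
  split_ifs with h
  · simp [NodeState.payload, D.phase_view, hi]
  · by_contra h'
    exact h (hI.of_outflow_ne_zero hi (Ne.symm h')).2.1

open Classical in
theorem evolve_label {v : Fin n} (hv : v ∈ D.nodes (i + 1)) :
    (D.evolve w i S v).label = transfer v ((S v).pruned (D.view i v)) fun u =>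
      if i % 3 = 2 then (S v).outflow (D.view i v) u + (S u).outflow (D.view i u) v else 0 := by
  rw [D.evolve_of_mem w i S hv]
  simp only [NodeState.next, D.phase_view, hI.id_eq]
  congr 1
  funext u
  split_ifs with hi
  · rw [hI.received_two hi]
  · rfl

theorem evolve_label_le {v : Fin n} (hv : v ∈ D.nodes (i + 1)) :
    (D.evolve w i S v).label v ≤ (S v).pruned (D.view i v) v := by
  rw [hI.evolve_label hv, transfer_self]
  exact Nat.sub_le _ _

/-- If `v` keeps some slack, its budget was not exhausted, so `u` has given away everything it
granted. -/
theorem evolve_tight_of_cleaned {v u : Fin n} (hvu : (D.graph (i + 1)).Adj v u)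
    (hc : (S v).Cleaned (D.view i v)) (hu : ¬ (D.evolve w i S u).dirty) :
    (D.evolve w i S v).label v = 0 ∨ (D.evolve w i S u).label u = 0 := by
  have hvV := D.adj_mem _ _ _ hvu
  have huV := D.adj_mem _ _ _ hvu.symm
  obtain ⟨hi, hb, hg⟩ := hc
  rw [D.phase_view] at hi
  rw [hI.id_eq] at hb
  obtain ⟨-, hbu, hgu⟩ := hI.granted hi v u (hg u hvu)
  rw [or_iff_not_imp_left]
  intro h
  rw [hI.evolve_label hvV, transfer_self] at h
  simp only [if_pos hi, Finset.sum_add_distrib] at h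
  have hlt : ∑ x, (S v).outflow (D.view i v) x < (S v).pruned (D.view i v) (S v).id := by
    rw [hI.id_eq]
    omega
  have hout : (S v).outflow (D.view i v) u = (S u).label u := by
    have h' : (S v).outflow (D.view i v) u = (S v).requests (D.view i v) u :=
      greedy_eq_of_sum_lt hlt u
    rw [h', NodeState.requests, hI.id_eq, if_pos ⟨hb, hvu⟩, hgu, Nat.add_sub_cancel]
  have hnc : ¬ (S u).Cleaned (D.view i u) := by
    rintro ⟨-, h', -⟩
    rw [hI.id_eq] at h'
    exact hvu.ne (WithTop.coe_injective (hbu.symm.trans h'))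
  -- A deletion at `u` could return weight beyond the grant, but it would also leave `u` dirty.
  have hnd : ¬ (D.view i u).disappeared.Nonempty := fun h' =>
    hu ((D.evolve_dirty w i S huV).2 ⟨hnc, Or.inr (Or.inl h')⟩)
  rw [hI.evolve_label huV, transfer_self, hI.pruned_self_of_empty hnd]
  simp only [if_pos hi, Finset.sum_add_distrib]
  have := Finset.single_le_sum (f := fun x => (S x).outflow (D.view i x) u)
    (fun _ _ => Nat.zero_le _) (Finset.mem_univ v)
  omega

/-- If neither endpoint was cleaned in this round, both were clean and stayed unmarked. Then the
edge is old, and without deletions at the endpoints a zero slack stays zero. -/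
theorem evolve_tight {v u : Fin n} (hvu : (D.graph (i + 1)).Adj v u)
    (hv : ¬ (D.evolve w i S v).dirty) (hu : ¬ (D.evolve w i S u).dirty) :
    (D.evolve w i S v).label v = 0 ∨ (D.evolve w i S u).label u = 0 := by
  have hvV := D.adj_mem _ _ _ hvu
  have huV := D.adj_mem _ _ _ hvu.symm
  by_cases hcv : (S v).Cleaned (D.view i v)
  · exact hI.evolve_tight_of_cleaned hvu hcv hu
  by_cases hcu : (S u).Cleaned (D.view i u)
  · exact (hI.evolve_tight_of_cleaned hvu.symm hcu hv).symm
  rw [D.evolve_dirty w i S hvV] at hv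
  rw [D.evolve_dirty w i S huV] at hu
  push Not at hv hu
  obtain ⟨hdv, hmv⟩ := hv hcv
  obtain ⟨hdu, hmu⟩ := hu hcu
  have huV' : u ∈ D.nodes i := by
    by_contra h
    exact hdu (by rw [hI.absent u h]; trivial)
  -- A new edge to an old node carries the flag `false`, which would have marked `v`.
  have hold : (D.graph i).Adj v u := by
    by_contra h
    refine hmv (Or.inr ⟨u, ⟨hvu, h⟩, ?_⟩)
    rw [DynamicGraph.received, if_pos hvu.symm]
    exact hI.not_fresh u huV'
  have key : ∀ x ∈ D.nodes (i + 1), ¬ NodeState.Marked (D.view i x) (D.received i S x) →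
      (S x).label x = 0 → (D.evolve w i S x).label x = 0 := by
    intro x hx hm h
    have := hI.evolve_label_le hx
    rw [hI.pruned_self_of_empty fun h' => hm (Or.inl h'), h] at this
    omega
  exact (hI.tight v u hold hdv hdu).imp (key v hvV hmv) (key u huV hmu)

theorem evolve : Invariant w (D.nodes (i + 1)) (D.graph (i + 1)) (i + 1) (D.evolve w i S) where
  absent v hv := D.evolve_of_notMem w i S hv
  not_fresh v hv := by rw [D.evolve_of_mem w i S hv]; rfl
  id_eq v := by
    by_cases hv : v ∈ D.nodes (i + 1)
    · rw [D.evolve_of_mem w i S hv]; exact hI.id_eq v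
    · rw [D.evolve_of_notMem w i S hv]; rfl
  zero_of_not_adj v u hu hvu := by
    by_cases hv : v ∈ D.nodes (i + 1)
    · rw [hI.evolve_label hv, transfer_of_ne hu, hI.pruned_zero_of_not_adj hu hvu, zero_add]
      split_ifs with hi
      · by_contra h
        rcases Nat.add_eq_zero_iff.not.1 h |> not_and_or.1 with h' | h'
        · exact hvu (hI.of_outflow_ne_zero hi h').2.1
        · exact hvu (hI.of_outflow_ne_zero hi h').2.1.symm
      · rfl
    · rw [D.evolve_of_notMem w i S hv]; exact Pi.single_eq_of_ne hu _
  sum_eq v := by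
    by_cases hv : v ∈ D.nodes (i + 1)
    · rw [hI.evolve_label hv, sum_transfer, hI.sum_pruned]
      · split_ifs with hi
        · have : (S v).outflow (D.view i v) v = 0 := by
            by_contra h
            exact (hI.of_outflow_ne_zero hi h).2.1.ne rfl
          rw [this]
        · rfl
      · split_ifs with hi
        · exact hI.sum_flow_le hi v
        · simp
    · rw [D.evolve_of_notMem w i S hv]; exact NodeState.sum_enter v _
  agree v u hvu := by
    rw [hI.evolve_label (D.adj_mem _ _ _ hvu), hI.evolve_label (D.adj_mem _ _ _ hvu.symm),
      transfer_of_ne hvu.ne', transfer_of_ne hvu.ne, hI.pruned_of_adj hvu,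
      hI.pruned_of_adj hvu.symm, hI.label_eq_of_adj_succ hvu]
    split_ifs
    · rw [add_comm ((S v).outflow _ _)]
    · rfl
  tight v u hvu hv hu := hI.evolve_tight hvu hv hu
  granted hi v u h := by
    have hi' : i % 3 = 1 := by omega
    have hv : v ∈ D.nodes (i + 1) := by
      by_contra hv
      rw [D.evolve_of_notMem w i S hv] at h
      exact h rfl
    have hg : (D.evolve w i S v).grants u = (D.received i S v u).2 := by
      rw [D.evolve_of_mem w i S hv]
      simp [NodeState.next, D.phase_view, hi']
    rw [hg] at h ⊢
    unfold DynamicGraph.received at h ⊢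
    split_ifs at h ⊢ with huv
    · have hu := D.adj_mem _ _ _ huv
      simp only [NodeState.payload, D.phase_view, hi', hI.id_eq] at h ⊢
      have hb : (S u).best = v := by
        by_contra hb
        simp [hb] at h
      refine ⟨huv.symm, ?_, ?_⟩
      · rw [D.evolve_of_mem w i S hu]
        simp [NodeState.next, D.phase_view, hi', hb]
      -- No weight moves in phase `1`, so the slack after the round is the granted one.
      · rw [hI.evolve_label hu, transfer_self]
        simp [hb, hi']
    · exact absurd rfl h

end Invariant

end

end DynNet

namespace DynNet

section

variable {n : ℕ}

/-! ### Topology changes -/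

/-- The number of topology changes at the beginning of round `i + 1`. -/
noncomputable def DynamicGraph.changesAt (D : DynamicGraph n) (i : ℕ) : ℕ :=
  (D.insertedNodes i).card + (D.insertedEdges i).ncard + (D.deletedEdges i).ncard

theorem DynamicGraph.nodes_eq_of_changesAt_eq_zero {D : DynamicGraph n} {i : ℕ}
    (h : D.changesAt i = 0) : D.nodes (i + 1) = D.nodes i := by
  have h' : (D.insertedNodes i).card = 0 := by unfold DynamicGraph.changesAt at h; omega
  exact (Finset.sdiff_eq_empty_iff_subset.1 (Finset.card_eq_zero.1 h')).antisymm (D.nodes_mono i)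

theorem DynamicGraph.graph_eq_of_changesAt_eq_zero {D : DynamicGraph n} {i : ℕ}
    (h : D.changesAt i = 0) : D.graph (i + 1) = D.graph i := by
  have hN := D.nodes_eq_of_changesAt_eq_zero h
  unfold DynamicGraph.changesAt at h
  have h1 : D.insertedEdges i = ∅ := (Set.ncard_eq_zero (Set.toFinite _)).1 (by omega)
  have h2 : D.deletedEdges i = ∅ := (Set.ncard_eq_zero (Set.toFinite _)).1 (by omega)
  ext u v
  constructor
  · intro huv
    by_contra hn
    have : s(u, v) ∈ D.insertedEdges i := by
      refine ⟨huv, hn, fun x hx => ?_⟩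
      rcases Sym2.mem_iff.1 hx with rfl | rfl
      · exact hN ▸ D.adj_mem _ _ _ huv
      · exact hN ▸ D.adj_mem _ _ _ huv.symm
    simp [h1] at this
  · intro huv
    by_contra hn
    have : s(u, v) ∈ D.deletedEdges i := ⟨huv, hn⟩
    simp [h2] at this

theorem card_endpoints_le (E : Set (Sym2 (Fin n))) (T : Finset (Fin n))
    (hT : ∀ v ∈ T, ∃ e ∈ E, v ∈ e) : T.card ≤ 2 * E.ncard := by
  classical
  have hsub : T ⊆ (Set.toFinite E).toFinset.biUnion Sym2.toFinset := by
    intro v hv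
    obtain ⟨e, he, hve⟩ := hT v hv
    simp only [Finset.mem_biUnion, Set.Finite.mem_toFinset, Sym2.mem_toFinset]
    exact ⟨e, he, hve⟩
  refine (Finset.card_le_card hsub).trans ?_
  rw [Set.ncard_eq_toFinset_card E (Set.toFinite E), mul_comm]
  refine Finset.card_biUnion_le_card_mul _ _ _ fun e _ => ?_
  induction e with
  | _ a b =>
    rw [Sym2.toFinset_mk_eq]
    exact Finset.card_le_two

/-- After phase `1` a node has the grants of all neighbours that serve it. -/
theorem DynamicGraph.evolve_grants (D : DynamicGraph n) (w : Fin n → ℕ) {i : ℕ}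
    {S : Fin n → NodeState n} (hi : i % 3 = 1) (h : D.changesAt i = 0) {v u : Fin n}
    (hvu : (D.graph i).Adj v u) (hb : (S u).best = v) : (D.evolve w i S v).grants u ≠ 0 := by
  have hv : v ∈ D.nodes (i + 1) := D.nodes_mono i (D.adj_mem _ _ _ hvu)
  rw [D.evolve_of_mem w i S hv]
  simp [NodeState.next, D.phase_view, hi, DynamicGraph.received,
    D.graph_eq_of_changesAt_eq_zero h, hvu.symm, NodeState.payload, hb]

theorem DynamicGraph.evolve_best_of_one (D : DynamicGraph n) (w : Fin n → ℕ) {i : ℕ}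
    {S : Fin n → NodeState n} (hi : i % 3 = 1) {v : Fin n} (hv : v ∈ D.nodes i) :
    (D.evolve w i S v).best = (S v).best := by
  rw [D.evolve_of_mem w i S (D.nodes_mono i hv)]
  simp [NodeState.next, D.phase_view, hi]

/-! ### Dirty nodes -/

open Classical in
/-- The dirty nodes among the nodes of `V`. -/
noncomputable def dirtyNodes (V : Finset (Fin n)) (S : Fin n → NodeState n) : Finset (Fin n) :=
  {v ∈ V | (S v).dirty}

theorem mem_dirtyNodes {V : Finset (Fin n)} {S : Fin n → NodeState n} {v : Fin n} :
    v ∈ dirtyNodes V S ↔ v ∈ V ∧ (S v).dirty := by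
  simp [dirtyNodes]

namespace Invariant

variable {D : DynamicGraph n} {w : Fin n → ℕ} {i : ℕ} {S : Fin n → NodeState n}
variable (hI : Invariant w (D.nodes i) (D.graph i) i S)
include hI

theorem starConsistent {v : Fin n} (hv : ¬ (S v).dirty)
    (h : ∀ u, (D.graph i).Adj v u → ¬ (S u).dirty) :
    StarConsistent w (D.graph i) (fun u => (S u).label) v where
  zero_of_not_adj u := hI.zero_of_not_adj v u
  sum_eq := hI.sum_eq v
  agree u := hI.agree v u
  tight := by
    rw [or_iff_not_imp_left]
    exact fun h' u hu => (hI.tight v u hu hv (h u hu)).resolve_left h'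

theorem consistent (h : dirtyNodes (D.nodes i) S = ∅) :
    Consistent w (D.nodes i) (D.graph i) fun u => (S u).label := by
  have h' : ∀ v ∈ D.nodes i, ¬ (S v).dirty := fun v hv hd => by
    simpa [h] using mem_dirtyNodes.2 ⟨hv, hd⟩
  exact fun v hv => hI.starConsistent (h' v hv) fun u hu => h' u (D.adj_mem _ _ _ hu.symm)

/-- A newcomer has `best = ⊤`, so it cannot be cleaned in the round of its insertion. -/
theorem dirty_of_inserted {v : Fin n} (hv : v ∈ D.insertedNodes i) :
    (D.evolve w i S v).dirty := by
  obtain ⟨h1, h2⟩ := Finset.mem_sdiff.1 hv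
  rw [D.evolve_dirty w i S h1, NodeState.Cleaned, hI.absent v h2]
  exact ⟨fun h => WithTop.top_ne_coe h.2.1, Or.inl trivial⟩

theorem of_evolve_dirty {v : Fin n} (hv : v ∈ D.nodes (i + 1))
    (hd : (D.evolve w i S v).dirty) :
    (v ∈ D.nodes i ∧ (S v).dirty) ∨ v ∈ D.insertedNodes i ∨
      ∃ e ∈ D.insertedEdges i ∪ D.deletedEdges i, v ∈ e := by
  by_cases hv' : v ∈ D.nodes i
  · rcases ((D.evolve_dirty w i S hv).1 hd).2 with h | ⟨u, hu⟩ | ⟨u, hu, hf⟩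
    · exact Or.inl ⟨hv', h⟩
    · exact Or.inr (Or.inr ⟨s(v, u), Or.inr hu, Sym2.mem_mk_left _ _⟩)
    · refine Or.inr (Or.inr ⟨s(v, u), Or.inl ⟨hu.1, hu.2, fun x hx => ?_⟩, Sym2.mem_mk_left _ _⟩)
      rcases Sym2.mem_iff.1 hx with rfl | rfl
      · exact hv'
      · by_contra hx'
        rw [DynamicGraph.received, if_pos hu.1.symm, hI.absent x hx'] at hf
        exact Bool.noConfusion hf
  · exact Or.inr (Or.inl (Finset.mem_sdiff.2 ⟨hv, hv'⟩))

/-- An edge change contributes at most its two endpoints, and a node insertion only the new node,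
whatever its degree. -/
theorem card_dirtyNodes_evolve_le :
    (dirtyNodes (D.nodes (i + 1)) (D.evolve w i S)).card ≤
      (dirtyNodes (D.nodes i) S).card + 2 * D.changesAt i := by
  classical
  set T := {v ∈ dirtyNodes (D.nodes (i + 1)) (D.evolve w i S) |
    ∃ e ∈ D.insertedEdges i ∪ D.deletedEdges i, v ∈ e} with hT
  have hsub : dirtyNodes (D.nodes (i + 1)) (D.evolve w i S) ⊆
      dirtyNodes (D.nodes i) S ∪ D.insertedNodes i ∪ T := by
    intro v hv
    obtain ⟨h1, h2⟩ := mem_dirtyNodes.1 hv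
    rcases hI.of_evolve_dirty h1 h2 with h | h | h
    · exact Finset.mem_union_left _ (Finset.mem_union_left _ (mem_dirtyNodes.2 h))
    · exact Finset.mem_union_left _ (Finset.mem_union_right _ h)
    · exact Finset.mem_union_right _ (Finset.mem_filter.2 ⟨hv, h⟩)
  have h1 := Finset.card_le_card hsub
  have h2 := Finset.card_union_le (dirtyNodes (D.nodes i) S ∪ D.insertedNodes i) T
  have h3 := Finset.card_union_le (dirtyNodes (D.nodes i) S) (D.insertedNodes i)
  have h4 := card_endpoints_le _ T fun v hv => (Finset.mem_filter.1 hv).2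
  have h5 := Set.ncard_union_le (D.insertedEdges i) (D.deletedEdges i)
  unfold DynamicGraph.changesAt
  omega

theorem dirtyNodes_evolve_subset (h : D.changesAt i = 0) :
    dirtyNodes (D.nodes (i + 1)) (D.evolve w i S) ⊆ dirtyNodes (D.nodes i) S := by
  intro v hv
  obtain ⟨h1, h2⟩ := mem_dirtyNodes.1 hv
  unfold DynamicGraph.changesAt at h
  have e1 : D.insertedNodes i = ∅ := Finset.card_eq_zero.1 (by omega)
  have e2 : D.insertedEdges i = ∅ := (Set.ncard_eq_zero (Set.toFinite _)).1 (by omega)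
  have e3 : D.deletedEdges i = ∅ := (Set.ncard_eq_zero (Set.toFinite _)).1 (by omega)
  rcases hI.of_evolve_dirty h1 h2 with h | h | ⟨e, h, -⟩
  · exact mem_dirtyNodes.2 h
  · simp [e1] at h
  · simp [e2, e3] at h

/-- After phase `0` the least dirty node is the best dirty node of itself and of its neighbours. -/
theorem evolve_best (hi : i % 3 = 0) (h : D.changesAt i = 0) {v u : Fin n}
    (hv : v ∈ dirtyNodes (D.nodes i) S) (hmin : ∀ x ∈ dirtyNodes (D.nodes i) S, v ≤ x)
    (hvu : u = v ∨ (D.graph i).Adj v u) : (D.evolve w i S u).best = v := by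
  classical
  have hN := D.nodes_eq_of_changesAt_eq_zero h
  have hG := D.graph_eq_of_changesAt_eq_zero h
  have hvd := mem_dirtyNodes.1 hv
  have hu : u ∈ D.nodes (i + 1) := by
    rw [hN]
    rcases hvu with rfl | hvu
    · exact hvd.1
    · exact D.adj_mem _ _ _ hvu.symm
  have hrec : ∀ x, (D.received i S u x).2 ≠ 0 ↔ (D.graph i).Adj x u ∧ (S x).dirty := by
    intro x
    rw [DynamicGraph.received, hG]
    split_ifs with hx
    · simp [NodeState.payload, D.phase_view, hi, hx]
    · simp [hx]
  rw [D.evolve_of_mem w i S hu]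
  simp only [NodeState.next, D.phase_view, hi, if_true, hI.id_eq]
  refine le_antisymm (Finset.min_le ?_) (Finset.le_min fun x hx => ?_)
  · rw [Finset.mem_filter, hrec]
    rcases hvu with rfl | hvu
    · exact ⟨Finset.mem_univ _, Or.inl ⟨rfl, hvd.2⟩⟩
    · exact ⟨Finset.mem_univ _, Or.inr ⟨hvu, hvd.2⟩⟩
  · refine WithTop.coe_le_coe.2 (hmin x (mem_dirtyNodes.2 ?_))
    rw [Finset.mem_filter, hrec] at hx
    rcases hx.2 with ⟨rfl, hd⟩ | ⟨hxu, hd⟩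
    · exact ⟨hN ▸ hu, hd⟩
    · exact ⟨D.adj_mem _ _ _ hxu, hd⟩

/-- After phase `2` a node that has got the grants of all its neighbours is clean. -/
theorem evolve_clean (hi : i % 3 = 2) (h : D.changesAt i = 0) {v : Fin n} (hv : v ∈ D.nodes i)
    (hb : (S v).best = v) (hg : ∀ u, (D.graph i).Adj v u → (S v).grants u ≠ 0) :
    ¬ (D.evolve w i S v).dirty := by
  rw [D.evolve_dirty w i S (D.nodes_mono i hv)]
  refine fun hd => hd.1 ⟨(D.phase_view i v).trans hi, ?_, fun u hu => hg u ?_⟩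
  · rw [hI.id_eq, hb]
  · rw [← D.graph_eq_of_changesAt_eq_zero h]
    exact hu

end Invariant

/-! ### Progress in a window without changes -/

theorem card_dirtyNodes_lt {D : DynamicGraph n} {w : Fin n → ℕ} {S : ℕ → Fin n → NodeState n}
    (hI : ∀ i, Invariant w (D.nodes i) (D.graph i) i (S i))
    (hS : ∀ i, S (i + 1) = D.evolve w i (S i)) (t : ℕ)
    (hpos : 0 < (dirtyNodes (D.nodes (3 * t)) (S (3 * t))).card)
    (h0 : D.changesAt (3 * t) = 0) (h1 : D.changesAt (3 * t + 1) = 0)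
    (h2 : D.changesAt (3 * t + 2) = 0) :
    (dirtyNodes (D.nodes (3 * t + 3)) (S (3 * t + 3))).card <
      (dirtyNodes (D.nodes (3 * t)) (S (3 * t))).card := by
  have hsub : ∀ i, D.changesAt i = 0 →
      dirtyNodes (D.nodes (i + 1)) (S (i + 1)) ⊆ dirtyNodes (D.nodes i) (S i) := fun i h => by
    rw [hS]
    exact (hI i).dirtyNodes_evolve_subset h
  obtain ⟨v, hv, hmin⟩ : ∃ v ∈ dirtyNodes (D.nodes (3 * t)) (S (3 * t)),
      ∀ x ∈ dirtyNodes (D.nodes (3 * t)) (S (3 * t)), v ≤ x :=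
    ⟨_, Finset.min'_mem _ (Finset.card_pos.1 hpos), fun x hx => Finset.min'_le _ x hx⟩
  have hN1 := D.nodes_eq_of_changesAt_eq_zero h0
  have hN2 : D.nodes (3 * t + 2) = D.nodes (3 * t + 1) := D.nodes_eq_of_changesAt_eq_zero h1
  have hG1 := D.graph_eq_of_changesAt_eq_zero h0
  have hG2 : D.graph (3 * t + 2) = D.graph (3 * t + 1) := D.graph_eq_of_changesAt_eq_zero h1
  have hvV : v ∈ D.nodes (3 * t + 1) := hN1 ▸ (mem_dirtyNodes.1 hv).1
  have hbest : ∀ u, u = v ∨ (D.graph (3 * t)).Adj v u → (S (3 * t + 1) u).best = v := by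
    intro u hu
    rw [hS]
    exact (hI _).evolve_best (by omega) h0 hv hmin hu
  have hclean : ¬ (S (3 * t + 3) v).dirty := by
    have e2 : S (3 * t + 2) = D.evolve w (3 * t + 1) (S (3 * t + 1)) := hS _
    have e3 : S (3 * t + 3) = D.evolve w (3 * t + 2) (S (3 * t + 2)) := hS _
    rw [e3]
    refine (hI (3 * t + 2)).evolve_clean (by omega) h2 (hN2 ▸ hvV) ?_ fun u hu => ?_
    · rw [e2, D.evolve_best_of_one w (by omega) hvV, hbest v (Or.inl rfl)]
    · rw [hG2] at hu
      rw [e2]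
      exact D.evolve_grants w (by omega) h1 hu (hbest u (Or.inr (hG1 ▸ hu)))
  refine Finset.card_lt_card (Finset.ssubset_iff_subset_ne.2
    ⟨((hsub _ h2).trans (hsub _ h1)).trans (hsub _ h0), fun h => ?_⟩)
  rw [← h] at hv
  exact hclean (mem_dirtyNodes.1 hv).2

/-! ### Runs of the algorithm -/

/-- The invariant bounds the numbers sent, so that encoding loses nothing; hence this identity and
the invariant advance together by induction. -/
theorem coverAlgorithm_run_succ {B : ℕ} {D : DynamicGraph n} {w : Fin n → ℕ}
    {L₀ : Fin n → Label n} (hB : ∀ v m, m ≤ w v + 1 → m.size + 1 ≤ B) {i : ℕ}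
    (hI : Invariant w (D.nodes i) (D.graph i) i ((coverAlgorithm n B).run D w L₀ i)) :
    (coverAlgorithm n B).run D w L₀ (i + 1) =
      D.evolve w i ((coverAlgorithm n B).run D w L₀ i) := by
  funext v
  by_cases hv : v ∈ D.nodes (i + 1)
  · refine (if_pos hv).trans (Eq.trans (congrArg (NodeState.next _ _) (funext fun u => ?_))
      (D.evolve_of_mem w i _ hv).symm)
    by_cases hu : (D.graph (i + 1)).Adj u v
    · refine Eq.trans ?_ (if_pos hu).symm
      exact (congrArg (fun o => Option.elim o (false, 0) decode) (if_pos hu)).trans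
        (decode_encode (hB u _ (hI.payload_le u v)))
    · refine Eq.trans ?_ (if_neg hu).symm
      exact congrArg (fun o => Option.elim o (false, 0) decode) (if_neg hu)
  · exact (if_neg hv).trans (D.evolve_of_notMem w i _ hv).symm

theorem coverAlgorithm_invariant {B : ℕ} {D : DynamicGraph n} {w : Fin n → ℕ}
    {L₀ : Fin n → Label n} (hB : ∀ v m, m ≤ w v + 1 → m.size + 1 ≤ B)
    (h : Consistent w (D.nodes 0) (D.graph 0) L₀) (i : ℕ) :
    Invariant w (D.nodes i) (D.graph i) i ((coverAlgorithm n B).run D w L₀ i) := by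
  induction i with
  | zero => exact Invariant.initial h (fun v hv => if_pos hv) fun v hv => if_neg hv
  | succ i ih =>
    rw [coverAlgorithm_run_succ hB ih]
    exact ih.evolve

/-- With no dirty node after round `j` and no change at the start of round `j + 1`, both labellings
of round `j + 1` are consistent. Thus every incorrect round is busy in the sense of `card_busy_le`.
-/
theorem incorrect_le {B : ℕ} {A : Algorithm n B} {D : DynamicGraph n} {w : Fin n → ℕ}
    {L₀ : Fin n → Label n} {f : ℕ → ℕ} (h0 : f 0 = 0)
    (hf : ∀ i, f i = 0 → Consistent w (D.nodes i) (D.graph i) (A.labels D w L₀ i))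
    (hstep : ∀ i, f (i + 1) ≤ f i + 2 * D.changesAt i)
    (hdrop : ∀ t, 0 < f (3 * t) → D.changesAt (3 * t) = 0 → D.changesAt (3 * t + 1) = 0 →
      D.changesAt (3 * t + 2) = 0 → f (3 * t + 3) < f (3 * t)) (i : ℕ) :
    A.incorrect D w L₀ i ≤ 9 * D.changes i := by
  classical
  refine le_trans ?_ (card_busy_le h0 hstep hdrop i)
  -- The successor matches round `j + 1` with the changes of index `j`; round `0` is never
  -- incorrect.
  rw [Algorithm.incorrect, ← Finset.card_image_of_injective _ Nat.succ_injective,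
    ← Set.ncard_coe_finset]
  refine Set.ncard_le_ncard ?_ (Finset.finite_toSet _)
  rintro j ⟨hj, hinc⟩
  cases j with
  | zero => exact absurd (hf 0 h0) (hinc.elim id id)
  | succ j =>
    rw [Finset.mem_coe]
    refine Finset.mem_image_of_mem _ (Finset.mem_filter.2 ⟨Finset.mem_range.2 hj, ?_⟩)
    by_contra hn
    have hs := hstep j
    have ha : D.changesAt j = 0 := by omega
    have hc := hf j (by omega)
    rcases hinc with h | h
    · rw [D.nodes_eq_of_changesAt_eq_zero ha, D.graph_eq_of_changesAt_eq_zero ha] at h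
      exact h hc
    · exact h (hf (j + 1) (by omega))

end

end DynNet

theorem mainTheorem8 :
    ∃ k : ℕ, ∀ p : Polynomial ℕ, ∃ c : ℕ, ∀ n : ℕ,
      ∃ A : DynNet.Algorithm n (c * (Nat.log 2 n + 1)),
        ∀ w : Fin n → ℕ, (∀ v, 1 ≤ w v ∧ w v ≤ p.eval n) →
        ∀ (D : DynNet.DynamicGraph n) (L₀ : Fin n → DynNet.Label n),
          DynNet.Consistent w (D.nodes 0) (D.graph 0) L₀ →
          -- the nodes start with the given labels, and none of them is dirty
          (∀ v ∈ D.nodes 0, A.labels D w L₀ 0 v = L₀ v ∧ ¬ A.DirtyAt D w L₀ 0 v) ∧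
          -- the amortized round complexity is at most `k`
          (∀ i, A.incorrect D w L₀ i ≤ k * D.changes i) ∧
          -- consistent labels give a 2-approximate minimum weight vertex cover
          (∀ i, DynNet.Consistent w (D.nodes i) (D.graph i) (A.labels D w L₀ i) →
            DynNet.IsTwoApproxCover w (D.nodes i) (D.graph i)
              (DynNet.cover (D.nodes i) (A.labels D w L₀ i))) ∧
          -- the star of a clean node with clean neighbours is consistent
          (∀ i, ∀ v ∈ D.nodes i, ¬ A.DirtyAt D w L₀ i v →
            (∀ u, (D.graph i).Adj v u → ¬ A.DirtyAt D w L₀ i u) →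
            DynNet.StarConsistent w (D.graph i) (A.labels D w L₀ i) v) ∧
          -- an inserted node is marked as dirty
          (∀ i, ∀ v ∈ D.insertedNodes i, A.DirtyAt D w L₀ (i + 1) v) ∧
          -- an edge change marks at most its endpoints, a node insertion only the inserted node
          (∀ i, ∀ v ∈ D.nodes (i + 1), A.DirtyAt D w L₀ (i + 1) v →
            (v ∈ D.nodes i ∧ A.DirtyAt D w L₀ i v) ∨ v ∈ D.insertedNodes i ∨
              ∃ e ∈ D.insertedEdges i ∪ D.deletedEdges i, v ∈ e) := by
  refine ⟨9, fun p => ?_⟩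
  obtain ⟨c, hc⟩ := DynNet.exists_size_le p
  refine ⟨c, fun n => ⟨DynNet.coverAlgorithm n _, fun w hw D L₀ hL => ?_⟩⟩
  set S := (DynNet.coverAlgorithm n (c * (Nat.log 2 n + 1))).run D w L₀ with hSdef
  have hB : ∀ v m, m ≤ w v + 1 → m.size + 1 ≤ c * (Nat.log 2 n + 1) := fun v m hm =>
    hc n m (hm.trans (Nat.succ_le_succ (hw v).2))
  have hI : ∀ i, DynNet.Invariant w (D.nodes i) (D.graph i) i (S i) :=
    DynNet.coverAlgorithm_invariant hB hL
  have hS : ∀ i, S (i + 1) = D.evolve w i (S i) := fun i =>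
    DynNet.coverAlgorithm_run_succ hB (hI i)
  have hstart : ∀ v ∈ D.nodes 0, S 0 v = DynNet.NodeState.start v (L₀ v) := fun v hv => if_pos hv
  refine ⟨fun v hv => ?_, ?_, fun i => ?_, fun i v _ hd hu => ?_, fun i v hv => ?_,
    fun i v hv hd => ?_⟩
  · exact ⟨congrArg DynNet.NodeState.label (hstart v hv), fun h =>
      (congrArg DynNet.NodeState.dirty (hstart v hv)).mp h⟩
  · refine DynNet.incorrect_le (f := fun i => (DynNet.dirtyNodes (D.nodes i) (S i)).card) ?_
      (fun i h => (hI i).consistent (Finset.card_eq_zero.1 h)) (fun i => ?_)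
      (DynNet.card_dirtyNodes_lt hI hS)
    · refine Finset.card_eq_zero.2 (Finset.eq_empty_of_forall_notMem fun v hv => ?_)
      obtain ⟨h1, h2⟩ := DynNet.mem_dirtyNodes.1 hv
      rw [hstart v h1] at h2
      exact h2
    · simp only [hS i]
      exact (hI i).card_dirtyNodes_evolve_le
  · exact DynNet.isTwoApproxCover_of_consistent (D.adj_mem i)
  · exact (hI i).starConsistent hd hu
  · have h := (hI i).dirty_of_inserted hv
    rw [← hS i] at h
    exact h
  · have hd' : (S (i + 1) v).dirty := hd
    rw [hS i] at hd'
    exact (hI i).of_evolve_dirty hv hd'
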